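/- An $\infty$-pseudo-metric on a set $X$ is a symmetric function $d\colon X\times X\to[0,\infty]$ with $d(x,x)=0$ and $d(x,y)\le d(x,z)+d(z,y)$. The space $X$ is $c$-discrete if $d(x,y)\ge c$ for all $x\ne y$. Its asymptotic dimension $\operatorname{asdim}X$ is the least integer $n\ge 0$ such that for every real $r>0$ one can write $X=X_0\cup\dots\cup X_n$, where each $X_i$ is the union of a family of subsets of uniformly bounded diameter such that points of different members are at distance at least $r$ (and $\operatorname{asdim}X=\infty$ if there is no such $n$). Let $r>0$ and let $B(x,r)$ denote the open $r$-ball around $x$ in $X$. A subset $A\subseteq X$ is of scale-$r$-dimension $0$ if there is a finite common bound for the diameters of its scale-$r$-components, i.e. of the sets of all points of $A$ that can be joined to a given point of $A$ by a sequence $x_0,\dots,x_n$ in $A$ with $B(x_i,r)\cap B(x_{i+1},r)\neq\emptyset$ for $0\le i<n$. For an integer $m\ge 0$, a subset is of scale-$r$-dimension at most $m-1$ if it is the union of $m$ subsets of scale-$r$-dimension $0$ (so it is empty if $m=0$). A finite array $(\alpha_0,\dots,\alpha_k)$ of non-decreasing functions from the positive integers to the non-negative integers, with $\alpha_0$ constant,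 is an integral APD profile of $X$ if for all positive integers $r_0\le r_1\le\dots\le r_k$ there is a decomposition $X=Z_0\cup\dots\cup Z_k$ such that each $Z_i$ is of scale-$r_i$-dimension at most $\alpha_i(r_{i-1})-1$ (for $i=0$ the argument $r_{-1}$ is irrelevant, since $\alpha_0$ is constant). **Theorem 6.3.** Let $X_1,X_2,\dots$ be non-empty $\infty$-pseudo-metric spaces of finite asymptotic dimension such that $X_i$ is $2i$-discrete for each $i\ge 1$. Equip all products with the $l_1$-$\infty$-pseudo-metric $\sum_i d(x_i,y_i)$, or equip all of them with the supremum-$\infty$-pseudo-metric $\sup_i d(x_i,y_i)$. In either case, for every $k\ge1$ the asymptotic dimension $\alpha(k)$ of $\prod_{i=1}^k X_i$ is finite, and $(1,\alpha)$ is an integral APD profile of $\prod_{i=1}^\infty X_i$, where $1$ denotes the constant function. -/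

import Mathlib

open scoped ENNReal

namespace APD

/-! An `∞`-pseudo-metric space is a set with a symmetric distance with values in `[0, ∞]` that
vanishes on the diagonal and satisfies the triangle inequality (the latter says nothing if one of
the two summands is `∞`).  This is Mathlib's `PseudoEMetricSpace`. -/

/-! ### Asymptotic dimension -/

section Asdim

variable {X : Type*} [PseudoEMetricSpace X]

/-- The members of the family `𝒰` have diameter at most `S`, for one real number `S > 0`. -/
def UniformlyBounded (𝒰 : Set (Set X)) : Prop :=
  ∃ S : ℝ, 0 < S ∧ ∀ U ∈ 𝒰, Metric.ediam U ≤ ENNReal.ofReal S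

/-- Points that belong to different members of `𝒰` are at distance at least `r`. -/
def RDisjoint (r : ℝ) (𝒰 : Set (Set X)) : Prop :=
  ∀ U ∈ 𝒰, ∀ V ∈ 𝒰, U ≠ V → ∀ x ∈ U, ∀ y ∈ V, ENNReal.ofReal r ≤ edist x y

variable (X) in
/-- The asymptotic dimension of `X` is at most `n`: for every `r > 0`, `X` is the union of sets
`X₀, …, Xₙ`, where `Xᵢ = ⋃₀ 𝒰ᵢ` for a uniformly bounded and `r`-disjoint family `𝒰ᵢ`. -/
def AsdimLE (n : ℕ) : Prop :=
  ∀ r : ℝ, 0 < r → ∃ 𝒰 : Fin (n + 1) → Set (Set X),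
    (⋃ i, ⋃₀ 𝒰 i) = Set.univ ∧ ∀ i, UniformlyBounded (𝒰 i) ∧ RDisjoint r (𝒰 i)

variable (X) in
/-- The asymptotic dimension of `X`: the least `n` such that `AsdimLE X n`, and `⊤` if there is
none. -/
noncomputable def asdim : ℕ∞ :=
  ⨅ (n : ℕ) (_ : AsdimLE X n), (n : ℕ∞)

variable (X) in
/-- `X` is `c`-discrete: distinct points are at distance at least `c`. -/
def IsDiscreteAt (c : ℝ) : Prop :=
  ∀ x y : X, x ≠ y → ENNReal.ofReal c ≤ edist x y

/-! ### Scale-`r`-dimension -/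

/-- The scale-`r`-component of `x` in the subset `A` of `X`: all `y` for which there is a
scale-`r`-chain `y = x₀, …, xₙ = x` in `A`, i.e. the `r`-balls (in `X`) of consecutive points
intersect.  It is empty if `x ∉ A`. -/
def scaleComponent (r : ℝ) (A : Set X) (x : X) : Set X :=
  {y | ∃ (n : ℕ) (c : ℕ → X), c 0 = y ∧ c n = x ∧ (∀ i ≤ n, c i ∈ A) ∧
    ∀ i < n, (Metric.eball (c i) (ENNReal.ofReal r) ∩
      Metric.eball (c (i + 1)) (ENNReal.ofReal r)).Nonempty}

/-- `A` is of scale-`r`-dimension `0`: the supremum of the diameters of its scale-`r`-components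
is finite. -/
def ScaleDimZero (r : ℝ) (A : Set X) : Prop :=
  ⨆ x : X, Metric.ediam (scaleComponent r A x) < ∞

/-- `A` is of scale-`r`-dimension at most `m - 1`: it is the union of `m` subsets of
scale-`r`-dimension `0`.  For `m = 0` this says that `A` is empty. -/
def ScaleDimLT (r : ℝ) (A : Set X) (m : ℕ) : Prop :=
  ∃ C : Fin m → Set X, A = ⋃ i, C i ∧ ∀ i, ScaleDimZero r (C i)

variable (X) in
/-- The array `(α₀, …, αₖ)` of functions on the positive integers is an integral APD profile of
`X`.  Here `Zᵢ` has scale-`rᵢ`-dimension at most `αᵢ(rᵢ₋₁) - 1`; since `α₀` is constant, its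
argument is irrelevant.  The value `0` of `αᵢ` is allowed and forces `Zᵢ = ∅`. -/
def IsIntegralAPDProfile {k : ℕ} (α : Fin (k + 1) → ℕ+ → ℕ) : Prop :=
  (∀ a b : ℕ+, α 0 a = α 0 b) ∧
  (∀ i, Monotone (α i)) ∧
  ∀ r : Fin (k + 1) → ℕ+, Monotone r →
    ∃ Z : Fin (k + 1) → Set X, (⋃ i, Z i) = Set.univ ∧
      ScaleDimLT (r 0 : ℝ) (Z 0) (α 0 (r 0)) ∧
      ∀ i : Fin k, ScaleDimLT (r i.succ : ℝ) (Z i.succ) (α i.succ (r i.castSucc))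

end Asdim

/-! ### Products -/

/-- The cartesian product of the `X i`, to be equipped with the `l₁` distance. -/
def L1Prod {ι : Type*} (X : ι → Type*) : Type _ := ∀ i, X i

/-- The cartesian product of the `X i`, to be equipped with the supremum distance. -/
def SupProd {ι : Type*} (X : ι → Type*) : Type _ := ∀ i, X i

/-- The distance of `x` and `y` is the sum of all `d(xᵢ, yᵢ)`. -/
noncomputable instance {ι : Type*} (X : ι → Type*) [∀ i, PseudoEMetricSpace (X i)] :
    PseudoEMetricSpace (L1Prod X) where
  edist x y := ∑' i, edist (x i) (y i)
  edist_self x := by simp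
  edist_comm x y := by simp only [edist_comm]
  edist_triangle x y z := by
    rw [← ENNReal.tsum_add]
    exact ENNReal.tsum_le_tsum fun i => edist_triangle _ _ _

/-- The distance of `x` and `y` is the supremum of all `d(xᵢ, yᵢ)`. -/
noncomputable instance {ι : Type*} (X : ι → Type*) [∀ i, PseudoEMetricSpace (X i)] :
    PseudoEMetricSpace (SupProd X) where
  edist x y := ⨆ i, edist (x i) (y i)
  edist_self x := by simp
  edist_comm x y := by simp only [edist_comm]
  edist_triangle x y z := iSup_le fun i => (edist_triangle _ (y i) _).trans
    (add_le_add (le_iSup (fun i => edist (x i) (y i)) i)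
      (le_iSup (fun i => edist (y i) (z i)) i))

end APD

/-! Fix `k ≤ r` and split a point of the product into its coordinates up to `k` (a point of `Y`, of
asymptotic dimension at most `n`), those in `(k, r]` (a point of `M`) and the rest. By discreteness,
steps shorter than `2r` fix the rest, and steps shorter than `2k` also fix the point of `M`.

Cover `Y` by `n + 1` widely disjoint families, the colours. Once shells of width `2r` around the
colours are removed, short steps cannot leave a neighbourhood of a member. Take disjoint levels of
such shells, one for each colour of `M` and `n` spare ones. `Z₀` avoids the level chosen by the
colour of the `M`-coordinate, which is constant along scale-`k` chains. The complement of `Z₀` is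
cut into `n` pieces, each avoiding a spare level and certain shells in the product that confine the
`M`-coordinate.

The pieces suffice by counting: each point of `Y` lies in a member of some colour, so at most `n`
colours are at positive distance and at most `n` levels are met. Outside `Z₀` one of them is taken,
so the remaining ones cannot block all `n` pieces. This is `exists_scaleDim_decomposition`;
`ScaleDimZero.of_traps` turns confinement into dimension `0`. -/

namespace APD

/-! ### Confinement of chains and neighbourhoods of disjoint families -/

section Scale

variable {X : Type*} [PseudoEMetricSpace X]

/-- A set is of scale-`r`-dimension `0` if each of its points lies in a set of diameter at most
`D` that cannot be left by steps of length less than `2r`. -/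
theorem ScaleDimZero.of_traps {r : ℕ} {A : Set X} {D : ℝ≥0∞} (hD : D < ∞)
    (h : ∀ x ∈ A, ∃ S : Set X, x ∈ S ∧ (∀ y ∈ S, ∀ z ∈ S, edist y z ≤ D) ∧
      ∀ y ∈ S, ∀ z ∈ A, edist y z < 2 * r → z ∈ S) :
    ScaleDimZero (r : ℝ) A := by
  refine lt_of_le_of_lt (iSup_le fun x => ?_) hD
  by_cases hx : x ∈ A
  · obtain ⟨S, hxS, hdiam, hstep⟩ := h x hx
    have hsub : scaleComponent (r : ℝ) A x ⊆ S := by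
      rintro y ⟨n, c, rfl, rfl, hA, hc⟩
      refine Nat.decreasingInduction (motive := fun i _ => c i ∈ S) (fun i hi ih => ?_) hxS
        (Nat.zero_le n)
      obtain ⟨p, hp, hp'⟩ := hc i hi
      refine hstep _ ih _ (hA i hi.le) ?_
      rw [Metric.mem_eball, ENNReal.ofReal_natCast] at hp hp'
      calc edist (c (i + 1)) (c i) ≤ edist p (c (i + 1)) + edist p (c i) :=
            edist_triangle_left _ _ _
        _ < r + r := ENNReal.add_lt_add hp' hp
        _ = 2 * r := (two_mul _).symm
    exact Metric.ediam_le fun y hy z hz => hdiam y (hsub hy) z (hsub hz)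
  · refine Metric.ediam_le ?_
    rintro y ⟨n, c, -, hn, hA, -⟩
    exact absurd (hn ▸ hA n le_rfl) hx

/-- In an `R`-disjoint family, a short step that ends near the union ends near the member at
which it started. -/
theorem RDisjoint.infEDist_lt {R : ℝ} {𝒱 : Set (Set X)} (h𝒱 : RDisjoint R 𝒱) {V : Set X}
    (hV : V ∈ 𝒱) {a b : ℝ≥0∞} (hab : a + b + a ≤ ENNReal.ofReal R) {x y : X}
    (hx : Metric.infEDist x V < a) (hxy : edist x y < b) (hy : Metric.infEDist y (⋃₀ 𝒱) < a) :
    Metric.infEDist y V < a := by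
  obtain ⟨u, hu, hxu⟩ := Metric.infEDist_lt_iff.1 hx
  obtain ⟨v, ⟨V', hV', hv⟩, hyv⟩ := Metric.infEDist_lt_iff.1 hy
  by_cases hVV : V = V'
  · subst hVV
    exact Metric.infEDist_lt_iff.2 ⟨v, hv, hyv⟩
  · refine absurd (hab.trans (h𝒱 V hV V' hV' hVV u hu v hv)) (not_le.2 ?_)
    calc edist u v ≤ edist u x + edist x y + edist y v := edist_triangle4 _ _ _ _
      _ < a + b + a := ENNReal.add_lt_add (ENNReal.add_lt_add (edist_comm u x ▸ hxu) hxy) hyv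

theorem infEDist_lt_add_of_edist_lt {s : Set X} {a b : ℝ≥0∞} {x y : X}
    (hx : Metric.infEDist x s < a) (hxy : edist x y < b) : Metric.infEDist y s < a + b :=
  (Metric.infEDist_le_infEDist_add_edist (x := y) (y := x)).trans_lt
    (ENNReal.add_lt_add hx (edist_comm x y ▸ hxy))

theorem edist_le_of_infEDist_lt {V : Set X} {a D : ℝ≥0∞} {x y : X} (hV : Metric.ediam V ≤ D)
    (hx : Metric.infEDist x V < a) (hy : Metric.infEDist y V < a) : edist x y ≤ a + D + a := by
  obtain ⟨u, hu, hxu⟩ := Metric.infEDist_lt_iff.1 hx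
  obtain ⟨v, hv, hyv⟩ := Metric.infEDist_lt_iff.1 hy
  calc edist x y ≤ edist x u + edist u v + edist v y := edist_triangle4 _ _ _ _
    _ ≤ a + D + a := add_le_add (add_le_add hxu.le ((Metric.edist_le_ediam_of_mem hu hv).trans hV))
        (edist_comm y v ▸ hyv.le)

theorem exists_common_bound {ι : Type*} [Finite ι] {𝒰 : ι → Set (Set X)}
    (h : ∀ i, UniformlyBounded (𝒰 i)) :
    ∃ D : ℝ≥0∞, D < ∞ ∧ ∀ i, ∀ U ∈ 𝒰 i, Metric.ediam U ≤ D := by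
  cases nonempty_fintype ι
  choose S _ hb using h
  refine ⟨∑ i, ENNReal.ofReal (S i), by simp [ENNReal.sum_lt_top], fun i U hU => ?_⟩
  exact (hb i U hU).trans
    (Finset.single_le_sum (f := fun i => ENNReal.ofReal (S i)) (fun _ _ => zero_le)
      (Finset.mem_univ i))

end Scale

/-! ### Asymptotic dimension of subspaces and finite products -/

section AsymptoticDimension

variable {X : Type*} [PseudoEMetricSpace X]

theorem exists_asdimLE_of_asdim_lt_top (h : asdim X < ⊤) : ∃ n, AsdimLE X n := by
  by_contra! hn
  simp [asdim, hn] at h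

theorem AsdimLE.asdim_le {n : ℕ} (h : AsdimLE X n) : asdim X ≤ n :=
  iInf₂_le n h

theorem exists_asdim_eq {n : ℕ} (h : AsdimLE X n) :
    ∃ m : ℕ, asdim X = m ∧ AsdimLE X m := by
  classical
  have hex : ∃ m, AsdimLE X m := ⟨n, h⟩
  refine ⟨Nat.find hex, le_antisymm (Nat.find_spec hex).asdim_le ?_, Nat.find_spec hex⟩
  exact le_iInf₂ fun m hm => Nat.cast_le.2 (Nat.find_min' hex hm)

/-- Asymptotic dimension is monotone under isometric embeddings. -/
theorem AsdimLE.of_edist_eq {Y : Type*} [PseudoEMetricSpace Y] {n : ℕ} (h : AsdimLE Y n)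
    (e : X → Y) (he : ∀ x y, edist (e x) (e y) = edist x y) : AsdimLE X n := by
  intro r hr
  obtain ⟨𝒰, hcov, h𝒰⟩ := h r hr
  refine ⟨fun i => (fun U => e ⁻¹' U) '' 𝒰 i, ?_, fun i => ⟨?_, ?_⟩⟩
  · refine Set.eq_univ_of_forall fun x => ?_
    have hx : e x ∈ ⋃ i, ⋃₀ 𝒰 i := hcov ▸ Set.mem_univ _
    obtain ⟨i, U, hU, hxU⟩ := Set.mem_iUnion.1 hx
    exact Set.mem_iUnion.2 ⟨i, _, ⟨U, hU, rfl⟩, hxU⟩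
  · obtain ⟨S, hS, hb⟩ := (h𝒰 i).1
    refine ⟨S, hS, ?_⟩
    rintro _ ⟨U, hU, rfl⟩
    refine Metric.ediam_le fun x hx y hy => ?_
    rw [← he]
    exact (Metric.edist_le_ediam_of_mem (s := U) hx hy).trans (hb U hU)
  · rintro _ ⟨U, hU, rfl⟩ _ ⟨V, hV, rfl⟩ hne x hx y hy
    rw [← he]
    exact (h𝒰 i).2 U hU V hV (fun hUV => hne (hUV ▸ rfl)) _ hx _ hy

/-- A space that projects to finitely many spaces of finite asymptotic dimension, such that the
distance is at most the sum of the distances of the projections, has finite asymptotic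
dimension. -/
theorem exists_asdimLE_of_finite_product {ι : Type*} [Finite ι] {Y : ι → Type*}
    [∀ i, PseudoEMetricSpace (Y i)] (p : ∀ i, X → Y i)
    (hp : ∀ i x y, edist (p i x) (p i y) ≤ edist x y)
    (hsum : ∀ x y, edist x y ≤ ∑' i, edist (p i x) (p i y))
    (hY : ∀ i, ∃ n, AsdimLE (Y i) n) : ∃ n, AsdimLE X n := by
  classical
  cases nonempty_fintype ι
  choose n hn using hY
  obtain ⟨N, hN⟩ : ∃ N, Fintype.card (∀ i, Fin (n i + 1)) = N + 1 :=
    Nat.exists_eq_succ_of_ne_zero Fintype.card_ne_zero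
  let φ : Fin (N + 1) ≃ ∀ i, Fin (n i + 1) := (Fintype.equivFinOfCardEq hN).symm
  refine ⟨N, fun r hr => ?_⟩
  choose 𝒰 hcov h𝒰 using fun i => hn i r hr
  -- A colour of the product is a tuple of colours of the factors; its members are boxes.
  refine ⟨fun c => (fun U : ∀ i, Set (Y i) => {x | ∀ i, p i x ∈ U i}) ''
    {U | ∀ i, U i ∈ 𝒰 i (φ c i)}, ?_, fun c => ⟨?_, ?_⟩⟩
  · refine Set.eq_univ_of_forall fun x => ?_
    have hx : ∀ i, ∃ j, ∃ U ∈ 𝒰 i j, p i x ∈ U := fun i => by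
      have : p i x ∈ ⋃ j, ⋃₀ 𝒰 i j := hcov i ▸ Set.mem_univ _
      simpa using this
    choose j U hU hxU using hx
    refine Set.mem_iUnion.2 ⟨φ.symm j, _, ⟨U, fun i => ?_, rfl⟩, hxU⟩
    simpa using hU i
  · choose S hS hb using fun i => (h𝒰 i (φ c i)).1
    have hS₀ : 0 ≤ ∑ i, S i := Finset.sum_nonneg fun i _ => (hS i).le
    -- The `1` keeps the bound positive when `ι` is empty.
    refine ⟨∑ i, S i + 1, by linarith, ?_⟩
    rintro _ ⟨U, hU, rfl⟩
    refine Metric.ediam_le fun x hx y hy => (hsum x y).trans ?_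
    rw [tsum_fintype]
    calc ∑ i, edist (p i x) (p i y) ≤ ∑ i, ENNReal.ofReal (S i) :=
          Finset.sum_le_sum fun i _ =>
            (Metric.edist_le_ediam_of_mem (hx i) (hy i)).trans (hb i _ (hU i))
      _ = ENNReal.ofReal (∑ i, S i) := (ENNReal.ofReal_sum_of_nonneg fun i _ => (hS i).le).symm
      _ ≤ _ := ENNReal.ofReal_le_ofReal (by linarith)
  · rintro _ ⟨U, hU, rfl⟩ _ ⟨V, hV, rfl⟩ hne x hx y hy
    obtain ⟨i, hi⟩ : ∃ i, U i ≠ V i := by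
      by_contra! h
      exact hne (by rw [funext h])
    exact ((h𝒰 i (φ c i)).2 _ (hU i) _ (hV i) hi _ (hx i) _ (hy i)).trans (hp i x y)

end AsymptoticDimension

end APD

/-! ### The decomposition at two scales -/

namespace APD

/-- Let `W` be covered, up to the locally constant map `τ`, by `Y` and `M`, where steps of length
less than `2k` do not change the coordinate in `M`.  If `Y` is of asymptotic dimension at most `n`
and `M` is of finite asymptotic dimension, then `W` is the union of a set of scale-`k`-dimension
`0` and a set of scale-`r`-dimension less than `n`. -/
theorem exists_scaleDim_decomposition {W Y M T : Type*} [PseudoEMetricSpace W]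
    [PseudoEMetricSpace Y] [PseudoEMetricSpace M] (π : W → Y) (q : W → M) (τ : W → T)
    {k r n m : ℕ} (hkr : k ≤ r) (hr : 0 < r)
    (hπ : ∀ w w', edist (π w) (π w') ≤ edist w w') (hq : ∀ w w', edist (q w) (q w') ≤ edist w w')
    (hsum : ∀ w w', τ w = τ w' → edist w w' ≤ edist (π w) (π w') + edist (q w) (q w'))
    (hτ : ∀ w w', edist w w' < 2 * r → τ w = τ w')
    (hqk : ∀ w w', edist w w' < 2 * k → q w = q w')
    (hY : AsdimLE Y n) (hM : AsdimLE M m) :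
    ∃ Z₀ Z₁ : Set W, Z₀ ∪ Z₁ = Set.univ ∧ ScaleDimZero (k : ℝ) Z₀ ∧ ScaleDimLT (r : ℝ) Z₁ n := by
  classical
  -- For `c < n` the intervals `[ρ c, ρ c + 2r)` are disjoint and end by `H`. Level `t` is the
  -- interval `[(t + 1)δ, (t + 2)δ)`: a shell of width `2r` from `σ t` on, padded by `H` on both
  -- sides.
  let ρ : ℕ → ℕ := fun c => 2 * r * (c + 1)
  let H : ℕ := 2 * r * (n + 1)
  let δ : ℕ := 2 * H + 2 * r
  let σ : ℕ → ℕ := fun t => (t + 1) * δ + H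
  let L : ℕ := σ (m + 1 + n)
  have hσL : ∀ t, t ≤ m + 1 + n → σ t ≤ L := fun t ht => by
    simp only [σ, L]; gcongr
  have hρH : ∀ c, c < n → ρ c ≤ H := fun c hc => by
    simp only [ρ, H]; gcongr
  -- Neighbourhoods of radius `H` (in `M`) or `L` (in `Y`) of different members of a colour stay
  -- `2r` apart.
  obtain ⟨𝒱, hVcov, h𝒱⟩ := hM ((2 * H + 2 * r : ℕ) : ℝ) (by positivity)
  obtain ⟨𝒰, hUcov, h𝒰⟩ := hY ((2 * L + 2 * r : ℕ) : ℝ) (by positivity)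
  obtain ⟨DY, hDY, hDU⟩ := exists_common_bound fun i => (h𝒰 i).1
  obtain ⟨DM, hDM, hDV⟩ := exists_common_bound fun i => (h𝒱 i).1
  have hV : ∀ μ : M, ∃ j, ∃ V ∈ 𝒱 j, μ ∈ V := fun μ => by
    have : μ ∈ ⋃ i, ⋃₀ 𝒱 i := hVcov ▸ Set.mem_univ _
    simpa using this
  have hU : ∀ y : Y, ∃ i, ∃ U ∈ 𝒰 i, y ∈ U := fun y => by
    have : y ∈ ⋃ i, ⋃₀ 𝒰 i := hUcov ▸ Set.mem_univ _
    simpa using this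
  choose j V hVmem hμV using hV
  let F : ℕ → Set Y := fun t => {y | ∃ i, (σ t : ℝ≥0∞) ≤ Metric.infEDist y (⋃₀ 𝒰 i) ∧
    Metric.infEDist y (⋃₀ 𝒰 i) < σ t + 2 * r}
  let G : Fin (m + 1) → Set W := fun a => {w | π w ∈ F a ∧ j (q w) = a}
  have hFstep : ∀ t, t ≤ m + 1 + n → ∀ i, ∀ U ∈ 𝒰 i, ∀ x y, Metric.infEDist x U < σ t →
      edist x y < 2 * r → y ∉ F t → Metric.infEDist y U < σ t := by
    intro t ht i U hUi x y hx hxy hy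
    refine (h𝒰 i).2.infEDist_lt hUi ?_ hx hxy ?_
    · rw [ENNReal.ofReal_natCast]
      have := hσL t ht
      exact_mod_cast (by omega : σ t + 2 * r + σ t ≤ 2 * L + 2 * r)
    · by_contra! hge
      exact hy ⟨i, hge, (Metric.infEDist_anti (Set.subset_sUnion_of_mem hUi)).trans_lt
        (infEDist_lt_add_of_edist_lt hx hxy)⟩
  have hGV : ∀ a w (b : ℝ≥0∞), Metric.infEDist w (G a) < b →
      Metric.infEDist (q w) (⋃₀ 𝒱 a) < b := by
    intro a w b hw
    obtain ⟨g, ⟨-, rfl⟩, hg⟩ := Metric.infEDist_lt_iff.1 hw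
    exact Metric.infEDist_lt_iff.2 ⟨q g, ⟨_, hVmem _, hμV _⟩, (hq _ _).trans_lt hg⟩
  have hpos : ∀ t, (0 : ℝ≥0∞) < σ t := fun t => by
    have : 0 < σ t := by positivity
    exact_mod_cast this
  have hρpos : ∀ c, (0 : ℝ≥0∞) < ρ c := fun c => by
    have : 0 < ρ c := by positivity
    exact_mod_cast this
  -- Avoiding the shells around `G a` keeps a chain near the `G a` where it starts, hence its
  -- `M`-coordinate near one member of `𝒱 a`, by `hGV`.
  let C : Fin n → Set W := fun c => {w | π w ∈ F (j (q w)) ∧ π w ∉ F (m + 1 + c) ∧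
    ∀ a, ¬ ((ρ c : ℝ≥0∞) ≤ Metric.infEDist w (G a) ∧ Metric.infEDist w (G a) < ρ c + 2 * r)}
  refine ⟨{w | π w ∉ F (j (q w))}, ⋃ c, C c, ?_, ?_, C, rfl, fun c => ?_⟩
  · refine Set.eq_univ_of_forall fun w => ?_
    by_cases hw : π w ∈ F (j (q w))
    swap
    · exact Or.inl hw
    refine Or.inr ?_
    by_contra hC
    have hlevel : ∀ t, σ t + 2 * r ≤ (t + 1 + 1) * δ := fun t => by
      simp only [σ, δ]; ring_nf; omega
    -- Each piece missing `w` puts `π w` in a level other than `j (q w)`: the spare level `m + 1 +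
    -- c`, or the level `a` of a point of `G a` within `H` of `w`, where the padding absorbs the
    -- distance.
    have hbad : ∀ c : Fin n, ∃ (t : ℕ) (i : Fin (n + 1)), t ≠ j (q w) ∧
        (((t + 1) * δ : ℕ) : ℝ≥0∞) ≤ Metric.infEDist (π w) (⋃₀ 𝒰 i) ∧
        Metric.infEDist (π w) (⋃₀ 𝒰 i) < ((t + 1 + 1) * δ : ℕ) ∧
        (t = m + 1 + c ∨ ∃ a : Fin (m + 1), t = a ∧ (ρ c : ℝ≥0∞) ≤ Metric.infEDist w (G a) ∧
          Metric.infEDist w (G a) < ρ c + 2 * r) := by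
      intro c
      by_cases hF : π w ∈ F (m + 1 + c)
      · obtain ⟨i, hi, hi'⟩ := hF
        refine ⟨m + 1 + c, i, by omega, le_trans ?_ hi, hi'.trans_le ?_, Or.inl rfl⟩
        · exact_mod_cast Nat.le_add_right _ _
        · exact_mod_cast hlevel _
      · obtain ⟨a, ha, ha'⟩ : ∃ a, (ρ c : ℝ≥0∞) ≤ Metric.infEDist w (G a) ∧
            Metric.infEDist w (G a) < ρ c + 2 * r := by
          by_contra h
          exact hC (Set.mem_iUnion.2 ⟨c, hw, hF, not_exists.1 h⟩)
        have haH : Metric.infEDist w (G a) < H := ha'.trans_le <| by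
          have : ρ c + 2 * r ≤ H := by
            calc ρ c + 2 * r = 2 * r * (c + 2) := by simp only [ρ]; ring
              _ ≤ 2 * r * (n + 1) := by gcongr 2 * r * ?_; omega
          exact_mod_cast this
        obtain ⟨g, ⟨⟨i, hi, hi'⟩, -⟩, hg⟩ := Metric.infEDist_lt_iff.1 haH
        have hwg : edist (π w) (π g) < H := (hπ w g).trans_lt hg
        refine ⟨a, i, ?_, ?_, ?_, Or.inr ⟨a, rfl, ha, ha'⟩⟩
        · intro haj
          have hwa : w ∈ G a := ⟨haj ▸ hw, (Fin.ext haj).symm⟩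
          rw [Metric.infEDist_zero_of_mem hwa] at ha
          exact absurd ha (not_le.2 (hρpos c))
        · by_contra! hlt
          refine absurd (infEDist_lt_add_of_edist_lt hlt hwg) (not_lt.2 (le_trans ?_ hi))
          exact_mod_cast le_rfl
        · refine (infEDist_lt_add_of_edist_lt hi' (edist_comm (π w) (π g) ▸ hwg)).trans_le ?_
          have : σ a + 2 * r + H ≤ (a + 1 + 1) * δ := by
            simp only [σ, δ]; ring_nf; omega
          exact_mod_cast this
    choose t i htj hi hi' ht using hbad
    obtain ⟨i₀, hi₀, hi₀'⟩ := hw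
    let t' : Option (Fin n) → ℕ := fun o => o.elim (j (q w)) t
    let i' : Option (Fin n) → Fin (n + 1) := fun o => o.elim i₀ i
    have hlow : ∀ o, (((t' o + 1) * δ : ℕ) : ℝ≥0∞) ≤ Metric.infEDist (π w) (⋃₀ 𝒰 (i' o)) := by
      rintro (_ | c)
      · refine le_trans ?_ hi₀
        exact_mod_cast Nat.le_add_right _ _
      · exact hi c
    have hupp : ∀ o, Metric.infEDist (π w) (⋃₀ 𝒰 (i' o)) < ((t' o + 1 + 1) * δ : ℕ) := by
      rintro (_ | c)
      · refine hi₀'.trans_le ?_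
        exact_mod_cast hlevel _
      · exact hi' c
    -- Different pieces are blocked by different levels, as the `ρ`-shells around one `G a` are
    -- disjoint.
    have hle : ∀ c c', t c = t c' → c ≤ c' := by
      intro c c' hcc
      rcases ht c with h | ⟨a, h, h1, -⟩ <;> rcases ht c' with h' | ⟨a', h', -, h2⟩
      · exact Fin.le_def.2 (by omega)
      · omega
      · omega
      · obtain rfl : a = a' := Fin.ext (by omega)
        have h3 : ρ c < ρ c' + 2 * r := by exact_mod_cast h1.trans_lt h2
        have h4 : 2 * r * (c + 1 : ℕ) < 2 * r * (c' + 2 : ℕ) := by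
          simp only [ρ] at h3; linarith
        have h5 := lt_of_mul_lt_mul_left h4 (Nat.zero_le _)
        exact Fin.le_def.2 (by omega)
    have ht' : Function.Injective t' := by
      rintro (_ | c) (_ | c') h
      · rfl
      · exact absurd h.symm (htj c')
      · exact absurd h (htj c)
      · exact congrArg some (le_antisymm (hle c c' h) (hle c' c h.symm))
    -- The distance to a colour lies in only one level, so the colour determines the level.
    have hi_le : ∀ o o', i' o = i' o' → t' o ≤ t' o' := by
      intro o o' h
      have h1 := (hlow o).trans_lt (h ▸ hupp o')
      have h2 := lt_of_mul_lt_mul_right (Nat.cast_lt.1 h1) (Nat.zero_le _)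
      omega
    have hinj : Function.Injective i' := fun o o' h =>
      ht' (le_antisymm (hi_le o o' h) (hi_le o' o h.symm))
    -- All `n + 1` colours are now at positive distance from `π w`, yet one of them contains it.
    have hsurj := ((Fintype.bijective_iff_injective_and_card i').2 ⟨hinj, by simp⟩).2
    obtain ⟨i₁, U, hU, hyU⟩ := hU (π w)
    obtain ⟨o, rfl⟩ := hsurj i₁
    have h0 := hlow o
    rw [Metric.infEDist_zero_of_mem (Set.mem_sUnion_of_mem hyU hU)] at h0
    have h1 : 0 < (t' o + 1) * δ := by positivity
    exact absurd (Nat.cast_pos.2 h1) (not_lt.2 h0)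
  · refine ScaleDimZero.of_traps (D := L + DY + L) (by finiteness) fun x hx => ?_
    obtain ⟨i, U, hU, hxU⟩ := hU (π x)
    have hjx : (j (q x) : ℕ) ≤ m + 1 + n := by omega
    -- With `q` fixed, the level to be avoided is the same along the whole chain.
    refine ⟨{w | q w = q x ∧ τ w = τ x ∧ Metric.infEDist (π w) U < σ (j (q x))},
      ⟨rfl, rfl, by rw [Metric.infEDist_zero_of_mem hxU]; exact hpos _⟩, ?_, ?_⟩
    · rintro y ⟨hy, hy', hyU⟩ z ⟨hz, hz', hzU⟩
      refine (hsum y z (hy'.trans hz'.symm)).trans ?_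
      rw [hy, hz, edist_self, add_zero]
      have : (σ (j (q x)) : ℝ≥0∞) ≤ L := by exact_mod_cast hσL _ hjx
      exact edist_le_of_infEDist_lt (hDU i U hU) (hyU.trans_le this) (hzU.trans_le this)
    · rintro y ⟨hy, hy', hyU⟩ z hz hyz
      have hyz' : edist y z < 2 * r := hyz.trans_le (by gcongr)
      have hqz : q z = q x := (hqk y z hyz).symm.trans hy
      refine ⟨hqz, (hτ y z hyz').symm.trans hy', ?_⟩
      refine hFstep _ hjx i U hU _ _ hyU ((hπ y z).trans_lt hyz') ?_
      rw [← hqz]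
      exact hz
  · refine ScaleDimZero.of_traps (D := (L + DY + L) + (H + DM + H)) (by finiteness) fun x hx => ?_
    obtain ⟨i, U, hU, hxU⟩ := hU (π x)
    have hc : m + 1 + (c : ℕ) ≤ m + 1 + n := by omega
    have hcH : (ρ c : ℝ≥0∞) ≤ H := by exact_mod_cast hρH c c.2
    refine ⟨{w | τ w = τ x ∧ Metric.infEDist (π w) U < σ (m + 1 + c) ∧
      Metric.infEDist w (G (j (q x))) < ρ c ∧ Metric.infEDist (q w) (V (q x)) < ρ c},
      ⟨rfl, ?_, ?_, ?_⟩, ?_, ?_⟩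
    · rw [Metric.infEDist_zero_of_mem hxU]; exact hpos _
    · rw [Metric.infEDist_zero_of_mem (s := G (j (q x))) ⟨hx.1, rfl⟩]; exact hρpos _
    · rw [Metric.infEDist_zero_of_mem (hμV _)]; exact hρpos _
    · rintro y ⟨hy, hyU, -, hyV⟩ z ⟨hz, hzU, -, hzV⟩
      refine (hsum y z (hy.trans hz.symm)).trans ?_
      have : (σ (m + 1 + c) : ℝ≥0∞) ≤ L := by exact_mod_cast hσL _ hc
      exact add_le_add
        (edist_le_of_infEDist_lt (hDU i U hU) (hyU.trans_le this) (hzU.trans_le this))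
        (edist_le_of_infEDist_lt (hDV _ _ (hVmem _)) (hyV.trans_le hcH) (hzV.trans_le hcH))
    · rintro y ⟨hy, hyU, hyG, hyV⟩ z hz hyz
      have hzG : Metric.infEDist z (G (j (q x))) < ρ c := by
        by_contra! hge
        exact hz.2.2 _ ⟨hge, infEDist_lt_add_of_edist_lt hyG hyz⟩
      refine ⟨(hτ y z hyz).symm.trans hy,
        hFstep _ hc i U hU _ _ hyU ((hπ y z).trans_lt hyz) hz.2.1, hzG, ?_⟩
      refine (h𝒱 _).2.infEDist_lt (hVmem _) ?_ hyV ((hq y z).trans_lt hyz) (hGV _ _ _ hzG)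
      rw [ENNReal.ofReal_natCast]
      have := hρH c c.2
      exact_mod_cast (by omega : ρ c + 2 * r + ρ c ≤ 2 * H + 2 * r)

end APD

/-! ### Coordinates of the infinite product -/

namespace APD

theorem isIntegralAPDProfile_one_of_decomposition {W : Type*} [PseudoEMetricSpace W] {α : ℕ+ → ℕ}
    (hα : Monotone α)
    (h : ∀ k r : ℕ+, k ≤ r → ∃ Z₀ Z₁ : Set W, Z₀ ∪ Z₁ = Set.univ ∧
      ScaleDimZero ((k : ℕ) : ℝ) Z₀ ∧ ScaleDimLT ((r : ℕ) : ℝ) Z₁ (α k)) :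
    IsIntegralAPDProfile W ![fun _ => 1, α] := by
  refine ⟨fun _ _ => rfl, fun i => ?_, fun r hr => ?_⟩
  · fin_cases i
    · exact monotone_const
    · exact hα
  · obtain ⟨Z₀, Z₁, hcov, h₀, h₁⟩ := h (r 0) (r 1) (hr (Fin.zero_le _))
    have h₀' : ScaleDimLT ((r 0 : ℕ) : ℝ) Z₀ 1 :=
      ⟨fun _ => Z₀, (Set.iUnion_const Z₀).symm, fun _ => h₀⟩
    refine ⟨![Z₀, Z₁], ?_, h₀', fun i => ?_⟩
    · rw [← hcov, Set.union_eq_iUnion]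
      ext x
      simp [Fin.exists_fin_two, or_comm]
    · fin_cases i
      exact h₁

/-- Discreteness of the factors with index at least `c` makes points of distance less than `2c`
agree in the coordinate `i`. -/
theorem IsDiscreteAt.eq_of_edist_lt {X : Type*} [PseudoEMetricSpace X] {i c : ℕ+}
    (h : IsDiscreteAt X (2 * (i : ℝ))) (hci : c ≤ i) {x y : X} (hxy : edist x y < 2 * (c : ℕ)) :
    x = y := by
  by_contra hne
  refine absurd (h x y hne) (not_le.2 (hxy.trans_le ?_))
  have : ENNReal.ofReal (2 * (i : ℝ)) = ((2 * (i : ℕ) : ℕ) : ℝ≥0∞) := by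
    rw [← ENNReal.ofReal_natCast]; norm_num
  rw [this]
  have hci' : (c : ℕ) ≤ i := hci
  exact_mod_cast (by omega : 2 * (c : ℕ) ≤ 2 * i)

section Product

variable {ι : Type*} {X : ι → Type*} [∀ i, PseudoEMetricSpace (X i)]

theorem L1Prod.edist_apply_le (x y : L1Prod X) (i : ι) : edist (x i) (y i) ≤ edist x y :=
  ENNReal.le_tsum i

theorem SupProd.edist_apply_le (x y : SupProd X) (i : ι) : edist (x i) (y i) ≤ edist x y :=
  le_iSup (fun i => edist (x i) (y i)) i

theorem SupProd.edist_le_tsum (x y : SupProd X) : edist x y ≤ ∑' i, edist (x i) (y i) :=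
  iSup_le fun i => ENNReal.le_tsum i

theorem L1Prod.exists_asdimLE [Finite ι] (h : ∀ i, asdim (X i) < ⊤) :
    ∃ n, AsdimLE (L1Prod X) n :=
  exists_asdimLE_of_finite_product (fun i (x : L1Prod X) => x i)
    (fun i x y => L1Prod.edist_apply_le x y i) (fun _ _ => le_rfl)
    fun i => exists_asdimLE_of_asdim_lt_top (h i)

theorem SupProd.exists_asdimLE [Finite ι] (h : ∀ i, asdim (X i) < ⊤) :
    ∃ n, AsdimLE (SupProd X) n :=
  exists_asdimLE_of_finite_product (fun i (x : SupProd X) => x i)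
    (fun i x y => SupProd.edist_apply_le x y i) SupProd.edist_le_tsum
    fun i => exists_asdimLE_of_asdim_lt_top (h i)

/-- Restriction to the coordinates in `p` does not increase the `l₁` distance. -/
theorem L1Prod.edist_restrict_le (p : ι → Prop) (x y : L1Prod X) :
    edist (α := L1Prod fun i : {i // p i} => X i) (fun i => x i) (fun i => y i) ≤ edist x y :=
  ENNReal.tsum_comp_le_tsum_of_injective (f := ((↑) : {i // p i} → ι)) Subtype.val_injective
    (fun i => edist (x i) (y i))

/-- Restriction to the coordinates in `p` does not increase the supremum distance. -/
theorem SupProd.edist_restrict_le (p : ι → Prop) (x y : SupProd X) :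
    edist (α := SupProd fun i : {i // p i} => X i) (fun i => x i) (fun i => y i) ≤ edist x y :=
  iSup_le fun i => SupProd.edist_apply_le x y i

theorem L1Prod.edist_le_add (p p' : ι → Prop) (x y : L1Prod X)
    (h : ∀ i, ¬ p i → ¬ p' i → x i = y i) :
    edist x y ≤ edist (α := L1Prod fun i : {i // p i} => X i) (fun i => x i) (fun i => y i) +
      edist (α := L1Prod fun i : {i // p' i} => X i) (fun i => x i) (fun i => y i) := by
  classical
  have hsub : ∀ p : ι → Prop, edist (α := L1Prod fun i : {i // p i} => X i) (fun i => x i)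
      (fun i => y i) = ∑' i, {i | p i}.indicator (fun i => edist (x i) (y i)) i := fun p =>
    tsum_subtype {i | p i} (fun i => edist (x i) (y i))
  rw [hsub, hsub, ← ENNReal.tsum_add]
  refine ENNReal.tsum_le_tsum fun i => ?_
  by_cases hi : p i
  · exact le_add_right (by simp [hi])
  by_cases hi' : p' i
  · exact le_add_left (by simp [hi'])
  simp [h i hi hi']

theorem SupProd.edist_le_add (p p' : ι → Prop) (x y : SupProd X)
    (h : ∀ i, ¬ p i → ¬ p' i → x i = y i) :
    edist x y ≤ edist (α := SupProd fun i : {i // p i} => X i) (fun i => x i) (fun i => y i) +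
      edist (α := SupProd fun i : {i // p' i} => X i) (fun i => x i) (fun i => y i) := by
  refine iSup_le fun i => ?_
  by_cases hi : p i
  · exact le_add_right (SupProd.edist_apply_le (X := fun i : {i // p i} => X i) (fun i => x i)
      (fun i => y i) ⟨i, hi⟩)
  by_cases hi' : p' i
  · exact le_add_left (SupProd.edist_apply_le (X := fun i : {i // p' i} => X i) (fun i => x i)
      (fun i => y i) ⟨i, hi'⟩)
  simp [h i hi hi']

open Classical in
/-- Extension of a family over the indices in `p` to one over the indices in `p'` by fixed
values. -/
noncomputable def extendBy (p p' : ι → Prop) (b : ∀ i, X i) (x : ∀ i : {i // p i}, X i) :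
    ∀ i : {i // p' i}, X i :=
  fun i => if h : p i then x ⟨i, h⟩ else b i

theorem L1Prod.edist_extendBy {p p' : ι → Prop} (hp : ∀ i, p i → p' i) (b : ∀ i, X i)
    (x y : L1Prod fun i : {i // p i} => X i) :
    edist (α := L1Prod fun i : {i // p' i} => X i) (extendBy p p' b x) (extendBy p p' b y) =
      edist x y := by
  refine ((Subtype.map_injective hp Function.injective_id).tsum_eq
    (f := fun i => edist (extendBy p p' b x i) (extendBy p p' b y i)) ?_).symm.trans ?_
  rotate_left
  · refine tsum_congr fun i => ?_
    simp [extendBy, Subtype.map, i.2]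
    rfl
  · intro i hi
    by_cases h : p i
    · exact ⟨⟨i, h⟩, rfl⟩
    · simp [extendBy, h] at hi

theorem SupProd.edist_extendBy {p p' : ι → Prop} (hp : ∀ i, p i → p' i) (b : ∀ i, X i)
    (x y : SupProd fun i : {i // p i} => X i) :
    edist (α := SupProd fun i : {i // p' i} => X i) (extendBy p p' b x) (extendBy p p' b y) =
      edist x y := by
  refine le_antisymm (iSup_le fun i => ?_) (iSup_le fun i => ?_)
  · by_cases h : p i
    · simpa [extendBy, h] using SupProd.edist_apply_le x y ⟨i, h⟩
    · simp [extendBy, h]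
  · refine le_trans ?_ (SupProd.edist_apply_le (X := fun i : {i // p' i} => X i)
      (extendBy p p' b x) (extendBy p p' b y) ⟨i, hp i i.2⟩)
    simp [extendBy, i.2]

end Product

end APD

theorem theorem6p3 {X : ℕ+ → Type*} [∀ i, PseudoEMetricSpace (X i)] [∀ i, Nonempty (X i)]
    (hfin : ∀ i, APD.asdim (X i) < ⊤)
    (hdisc : ∀ i : ℕ+, APD.IsDiscreteAt (X i) (2 * (i : ℝ))) :
    (∃ α : ℕ+ → ℕ,
      (∀ k : ℕ+, APD.asdim (APD.L1Prod fun i : {i : ℕ+ // i ≤ k} => X i) = (α k : ℕ∞)) ∧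
      APD.IsIntegralAPDProfile (APD.L1Prod X) ![fun _ => 1, α]) ∧
    (∃ α : ℕ+ → ℕ,
      (∀ k : ℕ+, APD.asdim (APD.SupProd fun i : {i : ℕ+ // i ≤ k} => X i) = (α k : ℕ∞)) ∧
      APD.IsIntegralAPDProfile (APD.SupProd X) ![fun _ => 1, α]) := by
  open APD in
  have hfinite : ∀ k : ℕ+, Finite {i : ℕ+ // i ≤ k} := fun k => (Set.finite_Iic k).to_subtype
  have hfinite' : ∀ k r : ℕ+, Finite {i : ℕ+ // k < i ∧ i ≤ r} := fun k r =>
    (Set.finite_Ioc k r).to_subtype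
  let b : ∀ i, X i := fun i => Classical.arbitrary (X i)
  constructor
  · have h : ∀ k : ℕ+, ∃ n : ℕ, asdim (L1Prod fun i : {i : ℕ+ // i ≤ k} => X i) = n ∧
        AsdimLE (L1Prod fun i : {i : ℕ+ // i ≤ k} => X i) n := fun k =>
      exists_asdim_eq (L1Prod.exists_asdimLE (X := fun i : {i : ℕ+ // i ≤ k} => X i)
        fun i => hfin i).choose_spec
    choose α hα hαle using h
    refine ⟨α, hα, isIntegralAPDProfile_one_of_decomposition (fun k l hkl => ?_)
      fun k r hkr => ?_⟩
    -- Monotonicity of `α`: filling the extra coordinates with base points embeds the smaller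
    -- product isometrically.
    · have := ((hαle l).of_edist_eq _ (L1Prod.edist_extendBy
        (fun i (hi : i ≤ k) => hi.trans hkl) b)).asdim_le
      rw [hα k] at this
      exact_mod_cast this
    · obtain ⟨m, hm⟩ := L1Prod.exists_asdimLE (X := fun i : {i : ℕ+ // k < i ∧ i ≤ r} => X i)
        fun i => hfin i
      refine exists_scaleDim_decomposition (W := L1Prod X)
        (Y := L1Prod fun i : {i : ℕ+ // i ≤ k} => X i)
        (M := L1Prod fun i : {i : ℕ+ // k < i ∧ i ≤ r} => X i)
        (fun w (i : {i : ℕ+ // i ≤ k}) => w i) (fun w (i : {i : ℕ+ // k < i ∧ i ≤ r}) => w i)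
        (fun w (i : {i : ℕ+ // r < i}) => w i) hkr r.pos
        (L1Prod.edist_restrict_le _) (L1Prod.edist_restrict_le _) ?_ ?_ ?_ (hαle k) hm
      · refine fun w w' h => L1Prod.edist_le_add _ _ w w' fun i hi hi' => ?_
        exact congrFun h ⟨i, by push Not at hi hi'; exact hi' hi⟩
      · exact fun w w' h => funext fun i =>
          (hdisc i).eq_of_edist_lt i.2.le ((L1Prod.edist_apply_le w w' i).trans_lt h)
      · exact fun w w' h => funext fun i =>
          (hdisc i).eq_of_edist_lt i.2.1.le ((L1Prod.edist_apply_le w w' i).trans_lt h)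
  · have h : ∀ k : ℕ+, ∃ n : ℕ, asdim (SupProd fun i : {i : ℕ+ // i ≤ k} => X i) = n ∧
        AsdimLE (SupProd fun i : {i : ℕ+ // i ≤ k} => X i) n := fun k =>
      exists_asdim_eq (SupProd.exists_asdimLE (X := fun i : {i : ℕ+ // i ≤ k} => X i)
        fun i => hfin i).choose_spec
    choose α hα hαle using h
    refine ⟨α, hα, isIntegralAPDProfile_one_of_decomposition (fun k l hkl => ?_)
      fun k r hkr => ?_⟩
    · have := ((hαle l).of_edist_eq _ (SupProd.edist_extendBy
        (fun i (hi : i ≤ k) => hi.trans hkl) b)).asdim_le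
      rw [hα k] at this
      exact_mod_cast this
    · obtain ⟨m, hm⟩ := SupProd.exists_asdimLE (X := fun i : {i : ℕ+ // k < i ∧ i ≤ r} => X i)
        fun i => hfin i
      refine exists_scaleDim_decomposition (W := SupProd X)
        (Y := SupProd fun i : {i : ℕ+ // i ≤ k} => X i)
        (M := SupProd fun i : {i : ℕ+ // k < i ∧ i ≤ r} => X i)
        (fun w (i : {i : ℕ+ // i ≤ k}) => w i) (fun w (i : {i : ℕ+ // k < i ∧ i ≤ r}) => w i)
        (fun w (i : {i : ℕ+ // r < i}) => w i) hkr r.pos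
        (SupProd.edist_restrict_le _) (SupProd.edist_restrict_le _) ?_ ?_ ?_ (hαle k) hm
      · refine fun w w' h => SupProd.edist_le_add _ _ w w' fun i hi hi' => ?_
        exact congrFun h ⟨i, by push Not at hi hi'; exact hi' hi⟩
      · exact fun w w' h => funext fun i =>
          (hdisc i).eq_of_edist_lt i.2.le ((SupProd.edist_apply_le w w' i).trans_lt h)
      · exact fun w w' h => funext fun i =>
          (hdisc i).eq_of_edist_lt i.2.1.le ((SupProd.edist_apply_le w w' i).trans_lt h)
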